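/- **Setting.** A signature $\sigma=(\mathrm{Dom},\mathrm{Ran})$ consists of a nonempty finite set $\mathrm{Dom}$ of variables and, for each $X\in\mathrm{Dom}$, a nonempty finite set $\mathrm{Ran}(X)$ of values. $\mathbf X=\mathbf x$ denotes a conjunction $X_1=x_1\wedge\dots\wedge X_n=x_n$ of equations with $x_i\in\mathrm{Ran}(X_i)$; it is *inconsistent* if it contains $X=x$ and $X=x'$ with $x\ne x'$, and *consistent* otherwise. The formulas of $\mathcal{CO}[\sigma]$ are given by $$\alpha::=X=x\mid\neg\alpha\mid\alpha\wedge\alpha\mid\alpha\vee\alpha\mid \mathbf X=\mathbf x\mathrel{\Box\!\!\to}\alpha ,$$ where the antecedent of $\mathrel{\Box\!\!\to}$ contains at least one equation. $X\neq x$ abbreviates $\neg(X=x)$, and $\bot$ abbreviates $X=x\wedge X\ne x$ for some fixed $X$ and $x$; an empty disjunction is $\bot$. In the rules below conjunctions of equations $\mathbf X=\mathbf x$ may be empty, and $\mathbf X=\mathbf x\mathrel{\Box\!\!\to}\varphi$ with empty antecedent stands for $\varphi$. **Semantics.** An assignment $s$ maps each $X\in\mathrm{Dom}$ to some $s(X)\in\mathrm{Ran}(X)$.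 A system of functions $\mathcal F$ consists of a set $\mathrm{En}(\mathcal F)\subseteq\mathrm{Dom}$ and, for each $V\in\mathrm{En}(\mathcal F)$, a set $PA_V\subseteq\mathrm{Dom}\setminus\{V\}$ of parents and a function $\mathcal F_V:\mathrm{Ran}(PA_V)\to\mathrm{Ran}(V)$. It is recursive if the graph with edges $(X,V)$, $X\in PA_V$, is acyclic; $s$ is compatible with $\mathcal F$ if $s(V)=\mathcal F_V(s(PA_V))$ for all $V\in\mathrm{En}(\mathcal F)$. A (recursive) causal team is a pair $T=(T^-,\mathcal F)$ of a possibly empty set $T^-$ of assignments and a recursive $\mathcal F$ with which all of them are compatible; a causal subteam of it is a causal team $(S^-,\mathcal F)$ with $S^-\subseteq T^-$. A (recursive) generalized causal team is any set $T$ of pairs $(s,\mathcal F)$ with $\mathcal F$ recursive and $s$ compatible with $\mathcal F$. For consistent $\mathbf X=\mathbf x$, $\mathcal F_{\mathbf X=\mathbf x}$ is the restriction of $\mathcal F$ to $\mathrm{En}(\mathcal F)\setminus\mathbf X$, and $s_{\mathbf X=\mathbf x}$ is the assignment defined recursively by $s_{\mathbf X=\mathbf x}(X_i)=x_i$, $s_{\mathbf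 X=\mathbf x}(V)=s(V)$ if $V\notin\mathrm{En}(\mathcal F)\cup\mathbf X$, and $s_{\mathbf X=\mathbf x}(V)=\mathcal F_V(s_{\mathbf X=\mathbf x}(PA_V))$ if $V\in\mathrm{En}(\mathcal F)\setminus\mathbf X$. The intervention yields $T_{\mathbf X=\mathbf x}=(\{s_{\mathbf X=\mathbf x}\mid s\in T^-\},\mathcal F_{\mathbf X=\mathbf x})$, respectively $T_{\mathbf X=\mathbf x}=\{(s_{\mathbf X=\mathbf x},\mathcal F_{\mathbf X=\mathbf x})\mid(s,\mathcal F)\in T\}$. Satisfaction $T\models^c\varphi$ for causal teams (respectively $T\models^g\varphi$ for generalized causal teams) is defined by: * $T\models X=x$ iff $s(X)=x$ for all $s\in T^-$ (resp. all $(s,\mathcal F)\in T$); * $T\models\neg\alpha$ iff $(\{s\},\mathcal F)\not\models\alpha$ for all $s\in T^-$ (resp. $\{(s,\mathcal F)\}\not\models\alpha$ for all $(s,\mathcal F)\in T$); * $T\models\varphi\wedge\psi$ iff $T\models\varphi$ and $T\models\psi$; * $T\models\varphi\vee\psi$ iff there are causal subteams $T_1,T_2$ of $T$ with $T_1^-\cup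 T_2^-=T^-$ (resp. subsets with $T_1\cup T_2=T$), $T_1\models\varphi$ and $T_2\models\psi$; * $T\models\mathbf X=\mathbf x\mathrel{\Box\!\!\to}\varphi$ iff $\mathbf X=\mathbf x$ is inconsistent or $T_{\mathbf X=\mathbf x}\models\varphi$. $\Delta\models^{c}\alpha$ (resp. $\Delta\models^{g}\alpha$) means that every recursive causal team (resp. every recursive generalized causal team) over $\sigma$ satisfying all formulas of $\Delta$ satisfies $\alpha$. **Deduction.** $\Delta\vdash\alpha$ means that $\alpha$ is derivable from assumptions in $\Delta$ by the following rules of natural deduction. * $\vdash\bigvee_{x\in\mathrm{Ran}(X)}X=x$; from $X=x$ infer $X\ne x'$, if $x\neq x'$. * Introduction and elimination of $\wedge$ and of $\vee$; $\neg$I (discharge $\alpha$ in a derivation of $\bot$, infer $\neg\alpha$); $\neg$E (from $\alpha$ and $\neg\alpha$ infer any $\varphi$); RAA (discharge $\neg\alpha$ in a derivation of $\bot$, infer $\alpha$). * Eff: $\vdash\mathbf X=\mathbf x\mathrel{\Box\!\!\to} Y=y$, if $Y=y$ is one of the equations in $\mathbf X=\mathbf x$. * Cmp: from $\mathbf X=\mathbf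 x\mathrel{\Box\!\!\to} W=w$ and $\mathbf X=\mathbf x\mathrel{\Box\!\!\to}\gamma$ infer $(\mathbf X=\mathbf x\wedge W=w)\mathrel{\Box\!\!\to}\gamma$, if $\gamma$ is $\mathrel{\Box\!\!\to}$-free. * From $\mathbf X=\mathbf x\mathrel{\Box\!\!\to}\bot$ infer any $\varphi$, if $\mathbf X=\mathbf x$ is consistent. * $\vdash\mathbf Y=\mathbf y\mathrel{\Box\!\!\to}\varphi$, if $\mathbf Y=\mathbf y$ contains $X=x$ and $X=x'$ with $x\ne x'$. * From $X=x\wedge X=x\wedge\mathbf Y=\mathbf y\mathrel{\Box\!\!\to}\varphi$ infer $X=x\wedge\mathbf Y=\mathbf y\mathrel{\Box\!\!\to}\varphi$, and conversely. * Sub: from $\mathbf X=\mathbf x\mathrel{\Box\!\!\to}\varphi$ and a derivation of $\psi$ whose only undischarged assumption is $\varphi$, infer $\mathbf X=\mathbf x\mathrel{\Box\!\!\to}\psi$. * From $\mathbf X=\mathbf x\mathrel{\Box\!\!\to}\varphi$ and $\mathbf X=\mathbf x\mathrel{\Box\!\!\to}\psi$ infer $\mathbf X=\mathbf x\mathrel{\Box\!\!\to}\varphi\wedge\psi$.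 * From $\mathbf X=\mathbf x\mathrel{\Box\!\!\to}\varphi\vee\psi$ infer $(\mathbf X=\mathbf x\mathrel{\Box\!\!\to}\varphi)\vee(\mathbf X=\mathbf x\mathrel{\Box\!\!\to}\psi)$, and conversely. * Extr: from $\mathbf X=\mathbf x\mathrel{\Box\!\!\to}(\mathbf Y=\mathbf y\mathrel{\Box\!\!\to}\varphi)$ infer $(\mathbf X'=\mathbf x'\wedge\mathbf Y=\mathbf y)\mathrel{\Box\!\!\to}\varphi$, if $\mathbf X=\mathbf x$ is consistent, where $\mathbf X'=\mathbf x'$ consists of the equations of $\mathbf X=\mathbf x$ whose variable is not in $\mathbf Y$. * Exp: from $(\mathbf X=\mathbf x\wedge\mathbf Y=\mathbf y)\mathrel{\Box\!\!\to}\varphi$ infer $\mathbf X=\mathbf x\mathrel{\Box\!\!\to}(\mathbf Y=\mathbf y\mathrel{\Box\!\!\to}\varphi)$, if $\mathbf X\cap\mathbf Y=\emptyset$. * From $\neg(\mathbf X=\mathbf x\mathrel{\Box\!\!\to}\alpha)$ infer $\mathbf X=\mathbf x\mathrel{\Box\!\!\to}\neg\alpha$. * Recur: for $k\ge2$ and distinct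 $X_1,\dots,X_k$, from $X_1\leadsto X_2,\ \dots,\ X_{k-1}\leadsto X_k$ infer $\neg(X_k\leadsto X_1)$, where $X\leadsto Y$ is the disjunction of all formulas $\mathbf Z=\mathbf z\mathrel{\Box\!\!\to}\big((X=x\mathrel{\Box\!\!\to} Y=y)\wedge(X=x'\mathrel{\Box\!\!\to} Y=y')\big)$ with $\mathbf Z\subseteq\mathrm{Dom}\setminus\{X,Y\}$, $\mathbf z\in\mathrm{Ran}(\mathbf Z)$, $x\ne x'$ in $\mathrm{Ran}(X)$ and $y\ne y'$ in $\mathrm{Ran}(Y)$. **Theorem (soundness and completeness of $\mathcal{CO}$).** For every signature $\sigma$ and every (possibly infinite) set $\Delta\cup\{\alpha\}$ of $\mathcal{CO}[\sigma]$-formulas, $$\Delta\vdash\alpha\iff\Delta\models^{c}\alpha\qquad\text{and}\qquad\Delta\vdash\alpha\iff\Delta\models^{g}\alpha .$$ -/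

import Mathlib

universe u v

namespace CausalLogic

/-- A signature: a nonempty finite set of variables, each with a nonempty finite range of values. -/
structure Signature where
  Dom : Type u
  Ran : Dom → Type v
  finiteDom : Finite Dom
  nonemptyDom : Nonempty Dom
  finiteRan : ∀ X, Finite (Ran X)
  nonemptyRan : ∀ X, Nonempty (Ran X)

attribute [instance] Signature.finiteDom Signature.nonemptyDom
  Signature.finiteRan Signature.nonemptyRan

/-! ### Equations and formulas -/

/-- An atomic equation `X = x` with `x ∈ Ran X`. -/
abbrev Eqn (σ : Signature.{u, v}) : Type (max u v) := Σ X : σ.Dom, σ.Ran X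

/-- A list of atomic equations stands for their conjunction `X₁ = x₁ ∧ … ∧ Xₙ = xₙ`.
It is consistent if it does not give two distinct values to the same variable. -/
def Consistent {σ : Signature.{u, v}} (E : List (Eqn σ)) : Prop :=
  ∀ (X : σ.Dom) (x x' : σ.Ran X), (⟨X, x⟩ : Eqn σ) ∈ E → (⟨X, x'⟩ : Eqn σ) ∈ E → x = x'

/-- The variables occurring in a conjunction of equations. -/
def vars {σ : Signature.{u, v}} (E : List (Eqn σ)) : Set σ.Dom :=
  {X | ∃ x : σ.Ran X, (⟨X, x⟩ : Eqn σ) ∈ E}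

open Classical in
/-- `remove E E'` keeps the equations of `E` whose variable does not occur in `E'`. -/
noncomputable def remove {σ : Signature.{u, v}} (E E' : List (Eqn σ)) : List (Eqn σ) :=
  E.filter fun e => decide (e.1 ∉ vars E')

/-- The formulas of the causal-observational language.  In `cf e E φ` the antecedent of the
counterfactual is the (nonempty) conjunction of the equations in `e :: E`. -/
inductive Form (σ : Signature.{u, v}) : Type (max u v)
  | eq (X : σ.Dom) (x : σ.Ran X) : Form σ
  | neg : Form σ → Form σ
  | and : Form σ → Form σ → Form σ
  | or : Form σ → Form σ → Form σ
  | cf : Eqn σ → List (Eqn σ) → Form σ → Form σ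

namespace Form

variable {σ : Signature.{u, v}}

/-- The counterfactual with antecedent the conjunction of the equations in a list.  With an empty
antecedent (nothing is intervened upon) it is the consequent itself. -/
def box : List (Eqn σ) → Form σ → Form σ
  | [], φ => φ
  | e :: E, φ => cf e E φ

/-- `⊥` abbreviates `X = x ∧ X ≠ x` (for some fixed choice of `X` and `x`). -/
noncomputable def bot : Form σ :=
  let X : σ.Dom := Classical.arbitrary σ.Dom
  let x : σ.Ran X := Classical.arbitrary (σ.Ran X)
  and (eq X x) (neg (eq X x))

/-- Finite disjunctions; the empty one is `⊥`. -/
noncomputable def bigOr : List (Form σ) → Form σ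
  | [] => bot
  | [φ] => φ
  | φ :: ψ :: L => or φ (bigOr (ψ :: L))

/-- The disjunction of all members of a finite family of formulas (in some fixed order). -/
noncomputable def iOr {ι : Type*} [Finite ι] (f : ι → Form σ) : Form σ :=
  letI := Fintype.ofFinite ι
  bigOr ((Finset.univ : Finset ι).toList.map f)

/-- Formulas without counterfactuals. -/
def BoxFree : Form σ → Prop
  | eq _ _ => True
  | neg φ => BoxFree φ
  | and φ ψ => BoxFree φ ∧ BoxFree ψ
  | or φ ψ => BoxFree φ ∧ BoxFree ψ
  | cf _ _ _ => False

/-- The conjunction `⋀_{V ∈ Z} V = z V`, for `z` a choice of values for the variables of `Z`. -/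
noncomputable def eqns (Z : Finset σ.Dom) (z : ∀ V : Z, σ.Ran V) : List (Eqn σ) :=
  (Finset.univ : Finset Z).toList.map fun V => ⟨V.1, z V⟩

/-- The indices of the disjuncts in "`X` causally affects `Y`": a set `Z` of variables avoiding
`X` and `Y` with values `z` for them, two distinct values `x, x'` of `X`, and two distinct values
`y, y'` of `Y`. -/
abbrev AffectsIndex (X Y : σ.Dom) : Type (max u v) :=
  (Σ Z : {Z : Finset σ.Dom // X ∉ Z ∧ Y ∉ Z}, ∀ V : Z.1, σ.Ran V) ×
    {p : σ.Ran X × σ.Ran X // p.1 ≠ p.2} × {q : σ.Ran Y × σ.Ran Y // q.1 ≠ q.2}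

/-- The formula `X ⇝ Y` ("`X` causally affects `Y`"): the disjunction of all formulas
`Z = z □→ ((X = x □→ Y = y) ∧ (X = x' □→ Y = y'))` with `Z` avoiding `X, Y`, and `x ≠ x'`,
`y ≠ y'`. -/
noncomputable def affects (X Y : σ.Dom) : Form σ :=
  iOr fun i : AffectsIndex X Y =>
    box (eqns i.1.1.1 i.1.2)
      (and (box [⟨X, i.2.1.1.1⟩] (eq Y i.2.2.1.1)) (box [⟨X, i.2.1.1.2⟩] (eq Y i.2.2.1.2)))

end Form

/-! ### Assignments, systems of functions, interventions -/

/-- Assignments over a signature. -/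
abbrev Assignment (σ : Signature.{u, v}) : Type (max u v) := ∀ V : σ.Dom, σ.Ran V

/-- A system of functions: a set `En` of endogenous variables, and for each of them a set of
parents (not containing the variable itself) and a function from values of the parents to values of
the variable. -/
structure FunSystem (σ : Signature.{u, v}) where
  En : Set σ.Dom
  PA : En → Set σ.Dom
  not_mem_PA : ∀ V : En, (V : σ.Dom) ∉ PA V
  fn : ∀ V : En, (∀ W : PA V, σ.Ran W) → σ.Ran V

namespace FunSystem

variable {σ : Signature.{u, v}}

/-- The edges of the graph of a system: `(X, Y)` is an edge iff `X` is a parent of `Y`. -/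
def Edge (F : FunSystem σ) (X Y : σ.Dom) : Prop := ∃ h : Y ∈ F.En, X ∈ F.PA ⟨Y, h⟩

/-- A system is recursive if its graph has no directed cycle. -/
def IsRecursive (F : FunSystem σ) : Prop := ∀ X, ¬ Relation.TransGen F.Edge X X

/-- An assignment is compatible with a system if it satisfies all the equations
`s(V) = F_V(s(PA_V))` for `V` endogenous. -/
def Compatible (F : FunSystem σ) (s : Assignment σ) : Prop :=
  ∀ V : F.En, s V = F.fn V fun W => s W

/-- The system left after an intervention: the restriction to `En \ vars E`. -/
def restrict (F : FunSystem σ) (E : List (Eqn σ)) : FunSystem σ where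
  En := F.En \ vars E
  PA V := F.PA ⟨V.1, V.2.1⟩
  not_mem_PA V := F.not_mem_PA ⟨V.1, V.2.1⟩
  fn V := F.fn ⟨V.1, V.2.1⟩

theorem IsRecursive.wf {F : FunSystem σ} (hF : F.IsRecursive) : WellFounded F.Edge := by
  have : Std.Irrefl (Relation.TransGen F.Edge) := ⟨hF⟩
  have h : WellFounded (Relation.TransGen F.Edge) :=
    Finite.wellFounded_of_trans_of_irrefl _
  exact Subrelation.wf (fun {a b} hab => Relation.TransGen.single hab) h

theorem IsRecursive.restrict {F : FunSystem σ} (hF : F.IsRecursive) (E : List (Eqn σ)) :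
    (F.restrict E).IsRecursive := fun X hX =>
  hF X (hX.lift id fun _ _ h => ⟨h.1.1, h.2⟩)

open Classical in
/-- The assignment `s_{X = x}` resulting from an intervention on a recursive system, by recursion
along the graph: a variable occurring in `E` gets the value it has there (used only for consistent
`E`, where this value is unique), any other endogenous variable is computed from the new values of
its parents, and any other exogenous variable keeps its value. -/
noncomputable def doAssignment (F : FunSystem σ) (hF : F.IsRecursive) (E : List (Eqn σ))
    (s : Assignment σ) : Assignment σ :=
  hF.wf.fix fun V ih =>
    if h : V ∈ vars E then h.choose
    else if hV : V ∈ F.En then F.fn ⟨V, hV⟩ fun W => ih W.1 ⟨hV, W.2⟩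
    else s V

theorem doAssignment_of_mem (F : FunSystem σ) (hF : F.IsRecursive) {E : List (Eqn σ)}
    (hE : Consistent E) (s : Assignment σ) {X : σ.Dom} {x : σ.Ran X}
    (hx : (⟨X, x⟩ : Eqn σ) ∈ E) : F.doAssignment hF E s X = x := by
  have h : X ∈ vars E := ⟨x, hx⟩
  rw [doAssignment, WellFounded.fix_eq, dif_pos h]
  exact hE X _ _ h.choose_spec hx

theorem doAssignment_of_endogenous (F : FunSystem σ) (hF : F.IsRecursive) (E : List (Eqn σ))
    (s : Assignment σ) {V : σ.Dom} (h : V ∉ vars E) (hV : V ∈ F.En) :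
    F.doAssignment hF E s V = F.fn ⟨V, hV⟩ fun W => F.doAssignment hF E s W := by
  conv_lhs => rw [doAssignment, WellFounded.fix_eq, dif_neg h, dif_pos hV]
  rfl

theorem doAssignment_of_exogenous (F : FunSystem σ) (hF : F.IsRecursive) (E : List (Eqn σ))
    (s : Assignment σ) {V : σ.Dom} (h : V ∉ vars E) (hV : V ∉ F.En) :
    F.doAssignment hF E s V = s V := by
  rw [doAssignment, WellFounded.fix_eq, dif_neg h, dif_neg hV]

theorem doAssignment_compatible (F : FunSystem σ) (hF : F.IsRecursive) (E : List (Eqn σ))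
    (s : Assignment σ) : (F.restrict E).Compatible (F.doAssignment hF E s) := fun V =>
  F.doAssignment_of_endogenous hF E s V.2.2 V.2.1

end FunSystem

/-! ### Causal team semantics -/

/-- A (recursive) causal team: a set of assignments (possibly empty) and a recursive system of
functions with which all of them are compatible. -/
structure CausalTeam (σ : Signature.{u, v}) where
  team : Set (Assignment σ)
  sys : FunSystem σ
  recursive : sys.IsRecursive
  compatible : ∀ s ∈ team, sys.Compatible s

namespace CausalTeam

variable {σ : Signature.{u, v}}

/-- Causal subteams: same function component, smaller team component. -/
def IsSubteam (S T : CausalTeam σ) : Prop := S.team ⊆ T.team ∧ S.sys = T.sys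

/-- The causal team `({s}, F)` for `s` in the team `(T⁻, F)`. -/
def single (T : CausalTeam σ) (s : Assignment σ) (hs : s ∈ T.team) : CausalTeam σ where
  team := {s}
  sys := T.sys
  recursive := T.recursive
  compatible := fun t ht => by
    rw [Set.mem_singleton_iff.1 ht]
    exact T.compatible s hs

/-- The causal team produced by an intervention. -/
noncomputable def doTeam (T : CausalTeam σ) (E : List (Eqn σ)) : CausalTeam σ where
  team := T.sys.doAssignment T.recursive E '' T.team
  sys := T.sys.restrict E
  recursive := T.recursive.restrict E
  compatible := by
    rintro _ ⟨s, -, rfl⟩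
    exact T.sys.doAssignment_compatible T.recursive E s

/-- Satisfaction over causal teams. -/
def Sat : CausalTeam σ → Form σ → Prop
  | T, .eq X x => ∀ s ∈ T.team, s X = x
  | T, .neg α => ∀ (s : Assignment σ) (hs : s ∈ T.team), ¬ Sat (T.single s hs) α
  | T, .and φ ψ => Sat T φ ∧ Sat T ψ
  | T, .or φ ψ => ∃ T₁ T₂ : CausalTeam σ, T₁.IsSubteam T ∧ T₂.IsSubteam T ∧
      T₁.team ∪ T₂.team = T.team ∧ Sat T₁ φ ∧ Sat T₂ ψ
  | T, .cf e E φ => ¬ Consistent (e :: E) ∨ Sat (T.doTeam (e :: E)) φ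

end CausalTeam

/-- Semantic consequence over (recursive) causal teams. -/
def EntailsC {σ : Signature.{u, v}} (Δ : Set (Form σ)) (α : Form σ) : Prop :=
  ∀ T : CausalTeam σ, (∀ δ ∈ Δ, T.Sat δ) → T.Sat α

/-! ### Generalized causal team semantics -/

/-- A (recursive) deterministic causal model: a pair `(s, F)` of an assignment and a recursive
system of functions compatible with each other. -/
structure Model (σ : Signature.{u, v}) where
  assignment : Assignment σ
  sys : FunSystem σ
  recursive : sys.IsRecursive
  compatible : sys.Compatible assignment

/-- The model `(s_{X = x}, F_{X = x})`. -/
noncomputable def Model.doModel {σ : Signature.{u, v}} (E : List (Eqn σ)) (m : Model σ) :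
    Model σ where
  assignment := m.sys.doAssignment m.recursive E m.assignment
  sys := m.sys.restrict E
  recursive := m.recursive.restrict E
  compatible := m.sys.doAssignment_compatible m.recursive E m.assignment

/-- A (recursive) generalized causal team: any set of recursive deterministic causal models. -/
abbrev GenTeam (σ : Signature.{u, v}) : Type (max u v) := Set (Model σ)

/-- Satisfaction over generalized causal teams. -/
def GenSat {σ : Signature.{u, v}} : GenTeam σ → Form σ → Prop
  | T, .eq X x => ∀ m ∈ T, m.assignment X = x
  | T, .neg α => ∀ m ∈ T, ¬ GenSat {m} α
  | T, .and φ ψ => GenSat T φ ∧ GenSat T ψ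
  | T, .or φ ψ => ∃ T₁ T₂ : GenTeam σ, T₁ ∪ T₂ = T ∧ GenSat T₁ φ ∧ GenSat T₂ ψ
  | T, .cf e E φ => ¬ Consistent (e :: E) ∨ GenSat (Model.doModel (e :: E) '' T) φ

/-- Semantic consequence over (recursive) generalized causal teams. -/
def EntailsG {σ : Signature.{u, v}} (Δ : Set (Form σ)) (α : Form σ) : Prop :=
  ∀ T : GenTeam σ, (∀ δ ∈ Δ, GenSat T δ) → GenSat T α

/-! ### The system of natural deduction -/

open Form in
/-- `Derives Γ φ`: there is a natural deduction derivation of `φ` all of whose undischarged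
assumptions belong to `Γ`. -/
inductive Derives {σ : Signature.{u, v}} : Set (Form σ) → Form σ → Prop
  | assumption {Γ : Set (Form σ)} {φ : Form σ} : φ ∈ Γ → Derives Γ φ
  -- value range assumptions
  | valDef {Γ : Set (Form σ)} (X : σ.Dom) : Derives Γ (iOr fun x : σ.Ran X => eq X x)
  | valUnq {Γ : Set (Form σ)} {X : σ.Dom} {x x' : σ.Ran X} :
      x ≠ x' → Derives Γ (eq X x) → Derives Γ (neg (eq X x'))
  -- conjunction, disjunction, negation
  | andI {Γ : Set (Form σ)} {φ ψ : Form σ} :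
      Derives Γ φ → Derives Γ ψ → Derives Γ (and φ ψ)
  | andE₁ {Γ : Set (Form σ)} {φ ψ : Form σ} : Derives Γ (and φ ψ) → Derives Γ φ
  | andE₂ {Γ : Set (Form σ)} {φ ψ : Form σ} : Derives Γ (and φ ψ) → Derives Γ ψ
  | orI₁ {Γ : Set (Form σ)} {φ ψ : Form σ} : Derives Γ φ → Derives Γ (or φ ψ)
  | orI₂ {Γ : Set (Form σ)} {φ ψ : Form σ} : Derives Γ φ → Derives Γ (or ψ φ)
  | orE {Γ : Set (Form σ)} {φ ψ α : Form σ} : Derives Γ (or φ ψ) →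
      Derives (insert φ Γ) α → Derives (insert ψ Γ) α → Derives Γ α
  | negI {Γ : Set (Form σ)} {α : Form σ} : Derives (insert α Γ) bot → Derives Γ (neg α)
  | negE {Γ : Set (Form σ)} {α φ : Form σ} : Derives Γ α → Derives Γ (neg α) → Derives Γ φ
  | raa {Γ : Set (Form σ)} {α : Form σ} : Derives (insert (neg α) Γ) bot → Derives Γ α
  -- counterfactuals
  | boxEff {Γ : Set (Form σ)} {E : List (Eqn σ)} {Y : σ.Dom} {y : σ.Ran Y} :
      (⟨Y, y⟩ : Eqn σ) ∈ E → Derives Γ (box E (eq Y y))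
  | boxCmp {Γ : Set (Form σ)} {E : List (Eqn σ)} {W : σ.Dom} {w : σ.Ran W} {γ : Form σ} :
      γ.BoxFree → Derives Γ (box E (eq W w)) → Derives Γ (box E γ) →
      Derives Γ (box (E ++ [⟨W, w⟩]) γ)
  | boxBotE {Γ : Set (Form σ)} {E : List (Eqn σ)} {φ : Form σ} :
      Consistent E → Derives Γ (box E bot) → Derives Γ φ
  | botBoxE {Γ : Set (Form σ)} {E : List (Eqn σ)} {X : σ.Dom} {x x' : σ.Ran X} {φ : Form σ} :
      x ≠ x' → (⟨X, x⟩ : Eqn σ) ∈ E → (⟨X, x'⟩ : Eqn σ) ∈ E → Derives Γ (box E φ)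
  | boxCtr {Γ : Set (Form σ)} {e : Eqn σ} {E : List (Eqn σ)} {φ : Form σ} :
      Derives Γ (box (e :: e :: E) φ) → Derives Γ (box (e :: E) φ)
  | boxWk {Γ : Set (Form σ)} {e : Eqn σ} {E : List (Eqn σ)} {φ : Form σ} :
      Derives Γ (box (e :: E) φ) → Derives Γ (box (e :: e :: E) φ)
  -- `φ` is the only assumption of the subderivation of `ψ`
  | boxSub {Γ : Set (Form σ)} {E : List (Eqn σ)} {φ ψ : Form σ} :
      Derives Γ (box E φ) → Derives {φ} ψ → Derives Γ (box E ψ)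
  | boxAndI {Γ : Set (Form σ)} {E : List (Eqn σ)} {φ ψ : Form σ} :
      Derives Γ (box E φ) → Derives Γ (box E ψ) → Derives Γ (box E (and φ ψ))
  | boxOrDst {Γ : Set (Form σ)} {E : List (Eqn σ)} {φ ψ : Form σ} :
      Derives Γ (box E (or φ ψ)) → Derives Γ (or (box E φ) (box E ψ))
  | boxOrDstInv {Γ : Set (Form σ)} {E : List (Eqn σ)} {φ ψ : Form σ} :
      Derives Γ (or (box E φ) (box E ψ)) → Derives Γ (box E (or φ ψ))
  | boxExtr {Γ : Set (Form σ)} {E E' : List (Eqn σ)} {φ : Form σ} :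
      Consistent E → Derives Γ (box E (box E' φ)) → Derives Γ (box (remove E E' ++ E') φ)
  | boxExp {Γ : Set (Form σ)} {E E' : List (Eqn σ)} {φ : Form σ} :
      Disjoint (vars E) (vars E') → Derives Γ (box (E ++ E') φ) → Derives Γ (box E (box E' φ))
  | negBoxE {Γ : Set (Form σ)} {E : List (Eqn σ)} {α : Form σ} :
      Derives Γ (neg (box E α)) → Derives Γ (box E (neg α))
  | recur {Γ : Set (Form σ)} {n : ℕ} (X : Fin (n + 2) → σ.Dom) :
      Function.Injective X →
      (∀ i : Fin (n + 1), Derives Γ (affects (X i.castSucc) (X i.succ))) →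
      Derives Γ (neg (affects (X (Fin.last (n + 1))) (X 0)))

end CausalLogic

/-! Satisfaction over both kinds of team is flat: a team satisfies a formula iff every member, taken
as a single causal model, makes it true under classical truth clauses (`CausalTeam.sat_iff`,
`genSat_iff`). Both consequence relations therefore coincide with `EntailsM`, consequence over
single models, and only that relation has to be matched with derivability.

Soundness rests on the post-intervention assignment being the unique solution of its defining
equations (`FunSystem.eq_doAssignment`), which shows how interventions compose. Recur is sound
because `X ⇝ Y` forces a directed path from `X` to `Y`, so a circle of such formulas would give a
cycle in the graph.

Completeness is a Henkin argument. If `α` is not derivable from `Δ`, then `Δ ∪ {¬α}` extends to a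
maximal consistent set `Γ`. For consistent `E` and each variable `V`, exactly one formula `E □→ V =
v` lies in `Γ`; these values form an assignment `R E`, the response to `E`. Eff, Cmp and Extr make
`R` a system of responses (`IsMaxConsistent.isResponse`). A recursive system of functions is read
off from it: the parents of `V` are the variables that affect `V` in some context, the value of `V`
is its response to fixing all other variables, and Recur excludes cycles. By uniqueness of
solutions, intervening with `E` on `R []` in this system yields `R E`. Since counterfactuals with
consistent antecedents commute with the connectives in `Γ` and nested ones merge, induction on
formulas shows that `Γ` is the theory of this model. -/

namespace CausalLogic

variable {σ : Signature.{u, v}}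

/-! ### Interventions -/

theorem Consistent.mono {E E' : List (Eqn σ)} (h : Consistent E) (hs : E' ⊆ E) : Consistent E' :=
  fun X x x' h₁ h₂ => h X x x' (hs h₁) (hs h₂)

theorem consistent_nil : Consistent ([] : List (Eqn σ)) := fun _ _ _ h => by simp at h

theorem consistent_singleton (e : Eqn σ) : Consistent [e] := by
  intro X x x' h h'
  simp only [List.mem_singleton] at h h'
  simpa using h.trans h'.symm

theorem vars_nil : vars ([] : List (Eqn σ)) = ∅ := by simp [vars]

theorem vars_append (E E' : List (Eqn σ)) : vars (E ++ E') = vars E ∪ vars E' := by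
  ext X; simp [vars, exists_or]

theorem mem_remove {E E' : List (Eqn σ)} {e : Eqn σ} :
    e ∈ remove E E' ↔ e ∈ E ∧ e.1 ∉ vars E' := by
  simp [remove]

theorem vars_remove_append (E E' : List (Eqn σ)) :
    vars (remove E E' ++ E') = vars E ∪ vars E' := by
  ext X
  rw [vars_append]
  constructor
  · rintro (⟨x, hx⟩ | h)
    · exact Or.inl ⟨x, (mem_remove.1 hx).1⟩
    · exact Or.inr h
  · intro h
    by_cases hX : X ∈ vars E'
    · exact Or.inr hX
    · obtain ⟨x, hx⟩ | h := h
      · exact Or.inl ⟨x, mem_remove.2 ⟨hx, hX⟩⟩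
      · exact Or.inr h

theorem remove_eq_self_of_disjoint {E E' : List (Eqn σ)} (h : Disjoint (vars E) (vars E')) :
    remove E E' = E := by
  rw [remove, List.filter_eq_self]
  intro e he
  simpa using fun h' => Set.disjoint_left.1 h ⟨e.2, he⟩ h'

theorem remove_eq_nil_of_subset {E E' : List (Eqn σ)} (h : E ⊆ E') : remove E E' = [] := by
  rw [List.eq_nil_iff_forall_not_mem]
  intro e he
  exact (mem_remove.1 he).2 ⟨e.2, h (mem_remove.1 he).1⟩

theorem Consistent.remove_append {E E' : List (Eqn σ)} (h : Consistent E) (h' : Consistent E') :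
    Consistent (remove E E' ++ E') := by
  intro X x x' h₁ h₂
  rw [List.mem_append, mem_remove] at h₁ h₂
  rcases h₁ with h₁ | h₁ <;> rcases h₂ with h₂ | h₂
  · exact h X x x' h₁.1 h₂.1
  · exact absurd ⟨_, h₂⟩ h₁.2
  · exact absurd ⟨_, h₁⟩ h₂.2
  · exact h' X x x' h₁ h₂

theorem Form.mem_eqns {Z : Finset σ.Dom} {z : ∀ V : Z, σ.Ran V} {e : Eqn σ} :
    e ∈ Form.eqns Z z ↔ ∃ h : e.1 ∈ Z, z ⟨e.1, h⟩ = e.2 := by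
  obtain ⟨X, x⟩ := e
  simp only [Form.eqns, List.mem_map, Finset.mem_toList, Finset.mem_univ, true_and]
  constructor
  · rintro ⟨V, hV⟩
    cases hV
    exact ⟨V.2, rfl⟩
  · rintro ⟨h, hz⟩
    exact ⟨⟨X, h⟩, Sigma.ext rfl (heq_of_eq hz)⟩

theorem Form.consistent_eqns (Z : Finset σ.Dom) (z : ∀ V : Z, σ.Ran V) :
    Consistent (Form.eqns Z z) := by
  intro X x x' h h'
  obtain ⟨_, h⟩ := mem_eqns.1 h
  obtain ⟨_, h'⟩ := mem_eqns.1 h'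
  exact h.symm.trans h'

/-! ### Uniqueness and composition of interventions -/

namespace FunSystem

/-- The restriction of a system of functions to a smaller set of endogenous variables. -/
def restrictTo (F : FunSystem σ) (A : Set σ.Dom) (h : A ⊆ F.En) : FunSystem σ where
  En := A
  PA V := F.PA ⟨V.1, h V.2⟩
  not_mem_PA V := F.not_mem_PA ⟨V.1, h V.2⟩
  fn V := F.fn ⟨V.1, h V.2⟩

/-- `restrict` is definitionally a `restrictTo`, so equality of restricted systems reduces to
equality of their sets of endogenous variables, without transporting the dependent fields. -/
theorem restrictTo_congr (F : FunSystem σ) {A B : Set σ.Dom} (h : A ⊆ F.En) (h' : B ⊆ F.En)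
    (hAB : A = B) : F.restrictTo A h = F.restrictTo B h' := by
  subst hAB; rfl

theorem restrict_nil (F : FunSystem σ) : F.restrict [] = F :=
  F.restrictTo_congr (A := F.En \ vars []) Set.sdiff_subset subset_rfl (by simp [vars_nil])

theorem restrict_congr (F : FunSystem σ) {E E' : List (Eqn σ)} (h : vars E = vars E') :
    F.restrict E = F.restrict E' :=
  F.restrictTo_congr (A := F.En \ vars E) (B := F.En \ vars E') Set.sdiff_subset Set.sdiff_subset
    (by rw [h])

theorem restrict_restrict (F : FunSystem σ) (E E' : List (Eqn σ)) :
    (F.restrict E).restrict E' = F.restrict (remove E E' ++ E') :=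
  F.restrictTo_congr (A := (F.En \ vars E) \ vars E') (B := F.En \ vars (remove E E' ++ E'))
    (Set.sdiff_subset.trans Set.sdiff_subset) Set.sdiff_subset
    (by rw [vars_remove_append, Set.sdiff_sdiff])

/-- The post-intervention assignment is the only solution of its defining equations. -/
theorem eq_doAssignment (F : FunSystem σ) (hF : F.IsRecursive) {E : List (Eqn σ)}
    (hE : Consistent E) {s t : Assignment σ}
    (h₁ : ∀ e ∈ E, t e.1 = e.2)
    (h₂ : ∀ (V : σ.Dom), V ∉ vars E → ∀ hV : V ∈ F.En, t V = F.fn ⟨V, hV⟩ fun W => t W)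
    (h₃ : ∀ V, V ∉ vars E → V ∉ F.En → t V = s V) : t = F.doAssignment hF E s := by
  funext V
  induction V using hF.wf.induction with
  | _ V ih =>
    by_cases hV : V ∈ vars E
    · obtain ⟨x, hx⟩ := hV
      rw [F.doAssignment_of_mem hF hE s hx]
      exact h₁ _ hx
    by_cases hV' : V ∈ F.En
    · rw [h₂ V hV hV', F.doAssignment_of_endogenous hF E s hV hV']
      congr 1
      funext W
      exact ih W ⟨hV', W.2⟩
    · rw [h₃ V hV hV', F.doAssignment_of_exogenous hF E s hV hV']

theorem doAssignment_nil (F : FunSystem σ) (hF : F.IsRecursive) {s : Assignment σ}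
    (hs : F.Compatible s) : F.doAssignment hF [] s = s :=
  (F.eq_doAssignment hF consistent_nil (by simp) (fun V _ hV => hs ⟨V, hV⟩)
    (fun _ _ _ => rfl)).symm

/-- The semantic content of Cmp. Only the assignments are claimed to agree: the systems of functions
left by the two interventions can differ at `e.1`, which is why Cmp is limited to box-free
consequents. -/
theorem doAssignment_append_of_eq (F : FunSystem σ) (hF : F.IsRecursive) {E : List (Eqn σ)}
    {s : Assignment σ} {e : Eqn σ} (hE : Consistent (E ++ [e]))
    (he : F.doAssignment hF E s e.1 = e.2) :
    F.doAssignment hF (E ++ [e]) s = F.doAssignment hF E s := by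
  have hE' : Consistent E := hE.mono (by simp)
  refine (F.eq_doAssignment hF hE ?_ ?_ ?_).symm
  · intro e' he'
    rcases List.mem_append.1 he' with h | h
    · exact F.doAssignment_of_mem hF hE' s h
    · rw [List.mem_singleton.1 h, he]
  · intro V hV hV'
    rw [vars_append] at hV
    exact F.doAssignment_of_endogenous hF E s (fun h => hV (Or.inl h)) hV'
  · intro V hV hV'
    rw [vars_append] at hV
    exact F.doAssignment_of_exogenous hF E s (fun h => hV (Or.inl h)) hV'

theorem doAssignment_congr (F : FunSystem σ) (hF : F.IsRecursive) {E E' : List (Eqn σ)}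
    (hE : Consistent E) (h : ∀ e, e ∈ E ↔ e ∈ E') (s : Assignment σ) :
    F.doAssignment hF E s = F.doAssignment hF E' s := by
  have hv : vars E = vars E' := by ext; simp [vars, h]
  refine F.eq_doAssignment hF (hE.mono fun e he => (h e).2 he)
    (fun e he => F.doAssignment_of_mem hF hE s ((h e).2 he)) ?_ ?_
  · intro V hV hV'
    exact F.doAssignment_of_endogenous hF E s (hv ▸ hV) hV'
  · intro V hV hV'
    exact F.doAssignment_of_exogenous hF E s (hv ▸ hV) hV'

/-- The later intervention overrides the earlier one on shared variables. The iterated result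
satisfies the equations that define the merged intervention, so uniqueness applies. -/
theorem doAssignment_doAssignment (F : FunSystem σ) (hF : F.IsRecursive) {E E' : List (Eqn σ)}
    (hE : Consistent E) (hE' : Consistent E') (s : Assignment σ) :
    (F.restrict E).doAssignment (hF.restrict E) E' (F.doAssignment hF E s) =
      F.doAssignment hF (remove E E' ++ E') s := by
  refine F.eq_doAssignment hF (hE.remove_append hE') ?_ ?_ ?_
  · intro e he
    by_cases h' : e.1 ∈ vars E'
    · have he' : e ∈ E' := by
        rcases List.mem_append.1 he with h | h
        · exact absurd h' (mem_remove.1 h).2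
        · exact h
      exact (F.restrict E).doAssignment_of_mem (hF.restrict E) hE' _ he'
    · have he' : e ∈ E := by
        rcases List.mem_append.1 he with h | h
        · exact (mem_remove.1 h).1
        · exact absurd ⟨_, h⟩ h'
      rw [(F.restrict E).doAssignment_of_exogenous (hF.restrict E) E' _ h'
        fun h => h.2 ⟨_, he'⟩]
      exact F.doAssignment_of_mem hF hE s he'
  · intro V hV hV'
    rw [vars_remove_append] at hV
    exact (F.restrict E).doAssignment_of_endogenous (hF.restrict E) E' _
      (fun h => hV (Or.inr h)) ⟨hV', fun h => hV (Or.inl h)⟩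
  · intro V hV hV'
    rw [vars_remove_append] at hV
    rw [(F.restrict E).doAssignment_of_exogenous (hF.restrict E) E' _
      (fun h => hV (Or.inr h)) (fun h => hV' h.1)]
    exact F.doAssignment_of_exogenous hF E s (fun h => hV (Or.inl h)) hV'

/-- Changing the value forced upon `X` changes only the descendants of `X`. -/
theorem transGen_of_doAssignment_ne (F : FunSystem σ) (hF : F.IsRecursive) {X : σ.Dom}
    (x x' : σ.Ran X) (s : Assignment σ) {V : σ.Dom} (hXV : X ≠ V)
    (h : F.doAssignment hF [⟨X, x⟩] s V ≠ F.doAssignment hF [⟨X, x'⟩] s V) :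
    Relation.TransGen F.Edge X V := by
  induction V using hF.wf.induction with
  | _ V ih =>
    have hv : ∀ x : σ.Ran X, V ∉ vars [(⟨X, x⟩ : Eqn σ)] := by
      rintro x ⟨y, hy⟩
      rw [List.mem_singleton] at hy
      exact hXV (congrArg Sigma.fst hy).symm
    by_cases hV : V ∈ F.En
    · rw [F.doAssignment_of_endogenous hF _ s (hv x) hV,
        F.doAssignment_of_endogenous hF _ s (hv x') hV] at h
      -- `V` is computed by the same function in both cases, so its values can differ only if some
      -- parent's values do.
      obtain ⟨W, hW⟩ : ∃ W : F.PA ⟨V, hV⟩,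
          F.doAssignment hF [⟨X, x⟩] s W ≠ F.doAssignment hF [⟨X, x'⟩] s W := by
        by_contra! hc
        exact h (congrArg _ (funext hc))
      have hWV : F.Edge W V := ⟨hV, W.2⟩
      by_cases hXW : X = W
      · rw [← hXW] at hWV
        exact .single hWV
      · exact (ih W hWV hXW hW).tail hWV
    · rw [F.doAssignment_of_exogenous hF _ s (hv x) hV,
        F.doAssignment_of_exogenous hF _ s (hv x') hV] at h
      exact absurd rfl h

end FunSystem

namespace Model

theorem eq_of_assignment_eq_of_sys_eq {m m' : Model σ} (h : m.assignment = m'.assignment)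
    (h' : m.sys = m'.sys) : m = m' := by
  cases m; cases m'
  cases h; cases h'
  rfl

theorem doModel_nil (m : Model σ) : m.doModel [] = m :=
  eq_of_assignment_eq_of_sys_eq (m.sys.doAssignment_nil m.recursive m.compatible)
    m.sys.restrict_nil

theorem doModel_congr {E E' : List (Eqn σ)} (hE : Consistent E) (h : ∀ e, e ∈ E ↔ e ∈ E')
    (m : Model σ) : m.doModel E = m.doModel E' :=
  eq_of_assignment_eq_of_sys_eq (m.sys.doAssignment_congr m.recursive hE h _)
    (m.sys.restrict_congr (by ext; simp [vars, h]))

theorem doModel_doModel {E E' : List (Eqn σ)} (hE : Consistent E) (hE' : Consistent E')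
    (m : Model σ) : (m.doModel E).doModel E' = m.doModel (remove E E' ++ E') :=
  eq_of_assignment_eq_of_sys_eq (m.sys.doAssignment_doAssignment m.recursive hE hE' _)
    (m.sys.restrict_restrict E E')

/-! ### Truth in a single causal model -/

/-- Truth of a formula in a single causal model. -/
def Truth : Model σ → Form σ → Prop
  | m, .eq X x => m.assignment X = x
  | m, .neg α => ¬ Truth m α
  | m, .and φ ψ => Truth m φ ∧ Truth m ψ
  | m, .or φ ψ => Truth m φ ∨ Truth m ψ
  | m, .cf e E φ => Consistent (e :: E) → Truth (m.doModel (e :: E)) φ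

theorem truth_box {m : Model σ} {E : List (Eqn σ)} {φ : Form σ} :
    m.Truth (.box E φ) ↔ (Consistent E → (m.doModel E).Truth φ) := by
  cases E with
  | nil => simp [Form.box, doModel_nil, consistent_nil]
  | cons e E => rw [Form.box, Truth]

theorem not_truth_bot (m : Model σ) : ¬ m.Truth .bot := by
  simp [Form.bot, Truth]

theorem truth_bigOr {m : Model σ} {L : List (Form σ)} :
    m.Truth (.bigOr L) ↔ ∃ φ ∈ L, m.Truth φ := by
  induction L with
  | nil => simp [Form.bigOr, not_truth_bot]
  | cons φ L ih =>
    cases L with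
    | nil => simp [Form.bigOr]
    | cons ψ L => rw [Form.bigOr, Truth, ih, ← List.exists_mem_cons_iff]

theorem truth_iOr {ι : Type*} [Finite ι] {m : Model σ} {f : ι → Form σ} :
    m.Truth (.iOr f) ↔ ∃ i, m.Truth (f i) := by
  simp [Form.iOr, truth_bigOr]

theorem truth_congr_of_boxFree {γ : Form σ} (hγ : γ.BoxFree) {m m' : Model σ}
    (h : m.assignment = m'.assignment) : m.Truth γ ↔ m'.Truth γ := by
  induction γ with
  | eq X x => simp [Truth, h]
  | neg φ ih => simp [Truth, ih hγ]
  | and φ ψ ih₁ ih₂ => simp [Truth, ih₁ hγ.1, ih₂ hγ.2]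
  | or φ ψ ih₁ ih₂ => simp [Truth, ih₁ hγ.1, ih₂ hγ.2]
  | cf e E φ => exact hγ.elim

/-- A path, not necessarily an edge: the dependence may pass through intermediate variables. It is
found in the graph left after intervening on `Z`, which is a subgraph of the original. -/
theorem transGen_of_truth_affects {m : Model σ} {X Y : σ.Dom} (hXY : X ≠ Y)
    (h : m.Truth (.affects X Y)) : Relation.TransGen m.sys.Edge X Y := by
  obtain ⟨⟨⟨Z, z⟩, x, y⟩, h⟩ := truth_iOr.1 h
  obtain ⟨h₁, h₂⟩ := truth_box.1 h (Form.consistent_eqns _ _)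
  have h₁ := truth_box.1 h₁ (consistent_singleton _)
  have h₂ := truth_box.1 h₂ (consistent_singleton _)
  have := FunSystem.transGen_of_doAssignment_ne _ (m.recursive.restrict (Form.eqns Z.1 z))
    x.1.1 x.1.2 (m.doModel (Form.eqns Z.1 z)).assignment hXY
    (fun h => y.2 (h₁.symm.trans (h.trans h₂)))
  exact this.lift id fun _ _ h => ⟨h.1.1, h.2⟩

end Model

/-! ### Flatness -/

/-- The model given by a member of a causal team. -/
def CausalTeam.model (T : CausalTeam σ) (s : Assignment σ) (hs : s ∈ T.team) : Model σ :=
  ⟨s, T.sys, T.recursive, T.compatible s hs⟩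

/-- Flatness. For a disjunction, the team is split into the members that make one disjunct true and
those that make the other true; the two parts may overlap. -/
theorem CausalTeam.sat_iff (T : CausalTeam σ) (φ : Form σ) :
    T.Sat φ ↔ ∀ (s : Assignment σ) (hs : s ∈ T.team), (T.model s hs).Truth φ := by
  induction φ generalizing T with
  | eq X x => rfl
  | neg φ ih =>
    simp only [Sat, Model.Truth]
    refine forall₂_congr fun s hs => not_congr ?_
    rw [ih]
    constructor
    · exact fun h => h s rfl
    · intro h t ht
      have hts : t = s := ht
      subst hts
      exact h
  | and φ ψ ih₁ ih₂ =>
    simp only [Sat, Model.Truth, ih₁, ih₂]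
    exact ⟨fun h s hs => ⟨h.1 s hs, h.2 s hs⟩, fun h => ⟨fun s hs => (h s hs).1,
      fun s hs => (h s hs).2⟩⟩
  | or φ ψ ih₁ ih₂ =>
    simp only [Sat, Model.Truth]
    constructor
    · rintro ⟨⟨A, F, hF, hA⟩, ⟨B, G, hG, hB⟩, ⟨-, hTF⟩, ⟨-, hTG⟩, hT, h₁, h₂⟩ s hs
      obtain ⟨C, H, hH, hC⟩ := T
      -- A subteam has the system of `T` only up to a propositional equality; once it is
      -- substituted, the models of its members are literally those of `T`.
      cases hTF; cases hTG
      rw [ih₁] at h₁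
      rw [ih₂] at h₂
      have hs' := hs
      rw [← hT] at hs'
      exact hs'.imp (h₁ s) (h₂ s)
    · intro h
      refine ⟨⟨{s | ∃ hs : s ∈ T.team, (T.model s hs).Truth φ}, T.sys, T.recursive,
          fun s hs => T.compatible s hs.1⟩,
        ⟨{s | ∃ hs : s ∈ T.team, (T.model s hs).Truth ψ}, T.sys, T.recursive,
          fun s hs => T.compatible s hs.1⟩,
        ⟨fun s hs => hs.1, rfl⟩, ⟨fun s hs => hs.1, rfl⟩, ?_, ?_, ?_⟩
      · ext s
        exact ⟨fun hs => hs.elim (fun h => h.1) (fun h => h.1),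
          fun hs => (h s hs).imp (fun h => ⟨hs, h⟩) (fun h => ⟨hs, h⟩)⟩
      · exact (ih₁ _).2 fun s hs => hs.2
      · exact (ih₂ _).2 fun s hs => hs.2
  | cf e E φ ih =>
    simp only [Sat, Model.Truth, ← imp_iff_not_or, ih]
    constructor
    · exact fun h s hs hE => h hE _ ⟨s, hs, rfl⟩
    · rintro h hE _ ⟨s, hs, rfl⟩
      exact h s hs hE

theorem genSat_iff (T : GenTeam σ) (φ : Form σ) : GenSat T φ ↔ ∀ m ∈ T, m.Truth φ := by
  induction φ generalizing T with
  | eq X x => rfl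
  | neg φ ih => simp [GenSat, Model.Truth, ih]
  | and φ ψ ih₁ ih₂ =>
    simp only [GenSat, Model.Truth, ih₁, ih₂]
    exact ⟨fun h s hs => ⟨h.1 s hs, h.2 s hs⟩, fun h => ⟨fun s hs => (h s hs).1,
      fun s hs => (h s hs).2⟩⟩
  | or φ ψ ih₁ ih₂ =>
    simp only [GenSat, Model.Truth, ih₁, ih₂]
    constructor
    · rintro ⟨T₁, T₂, rfl, h₁, h₂⟩ m hm
      exact hm.imp (h₁ m) (h₂ m)
    · intro h
      refine ⟨{m ∈ T | m.Truth φ}, {m ∈ T | m.Truth ψ}, ?_, fun m hm => hm.2, fun m hm => hm.2⟩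
      ext m
      exact ⟨fun hm => hm.elim And.left And.left,
        fun hm => (h m hm).imp (And.intro hm) (And.intro hm)⟩
  | cf e E φ ih =>
    simp only [GenSat, Model.Truth, ← imp_iff_not_or, ih, Set.forall_mem_image]
    exact ⟨fun h m hm hE => h hE hm, fun h hE m hm => h m hm hE⟩

/-- Consequence over single causal models. -/
def EntailsM (Δ : Set (Form σ)) (α : Form σ) : Prop :=
  ∀ m : Model σ, (∀ δ ∈ Δ, m.Truth δ) → m.Truth α

/-- A single model is a team with one member, and by flatness a team satisfies a formula as soon as
each member does. -/
theorem entailsC_iff {Δ : Set (Form σ)} {α : Form σ} : EntailsC Δ α ↔ EntailsM Δ α := by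
  constructor
  · intro h m hm
    let T : CausalTeam σ := ⟨{m.assignment}, m.sys, m.recursive, by
      rintro s rfl; exact m.compatible⟩
    refine (T.sat_iff α).1 (h T fun δ hδ => (T.sat_iff δ).2 ?_) m.assignment rfl
    rintro s rfl
    exact hm δ hδ
  · intro h T hT
    exact (T.sat_iff α).2 fun s hs => h _ fun δ hδ => (T.sat_iff δ).1 (hT δ hδ) s hs

theorem entailsG_iff {Δ : Set (Form σ)} {α : Form σ} : EntailsG Δ α ↔ EntailsM Δ α := by
  constructor
  · intro h m hm
    simpa [genSat_iff] using h {m} (by simpa [genSat_iff] using hm)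
  · intro h T hT
    exact (genSat_iff T α).2 fun m hm => h m fun δ hδ => (genSat_iff T δ).1 (hT δ hδ) m hm

/-! ### Soundness -/

theorem Derives.sound {Γ : Set (Form σ)} {φ : Form σ} (h : Derives Γ φ) : EntailsM Γ φ := by
  induction h with
  | assumption h => exact fun m hm => hm _ h
  | valDef X => exact fun m _ => Model.truth_iOr.2 ⟨_, rfl⟩
  | valUnq hx _ ih => exact fun m hm h' => hx ((ih m hm).symm.trans h')
  | andI _ _ ih₁ ih₂ => exact fun m hm => ⟨ih₁ m hm, ih₂ m hm⟩
  | andE₁ _ ih => exact fun m hm => (ih m hm).1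
  | andE₂ _ ih => exact fun m hm => (ih m hm).2
  | orI₁ _ ih => exact fun m hm => Or.inl (ih m hm)
  | orI₂ _ ih => exact fun m hm => Or.inr (ih m hm)
  | orE _ _ _ ih ih₁ ih₂ =>
    exact fun m hm => (ih m hm).elim (fun h => ih₁ m (Set.forall_mem_insert.2 ⟨h, hm⟩))
      (fun h => ih₂ m (Set.forall_mem_insert.2 ⟨h, hm⟩))
  | negI _ ih => exact fun m hm h => m.not_truth_bot (ih m (Set.forall_mem_insert.2 ⟨h, hm⟩))
  | negE _ _ ih₁ ih₂ => exact fun m hm => absurd (ih₁ m hm) (ih₂ m hm)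
  | raa _ ih =>
    exact fun m hm => by_contra fun h => m.not_truth_bot (ih m (Set.forall_mem_insert.2 ⟨h, hm⟩))
  | boxEff h =>
    exact fun m hm => Model.truth_box.2 fun hE =>
      m.sys.doAssignment_of_mem m.recursive hE _ h
  | boxCmp hγ _ _ ih₁ ih₂ =>
    intro m hm
    refine Model.truth_box.2 fun hE => ?_
    have hE' := hE.mono (E' := _) (List.subset_append_left _ _)
    refine (Model.truth_congr_of_boxFree hγ ?_).2 (Model.truth_box.1 (ih₂ m hm) hE')
    exact m.sys.doAssignment_append_of_eq m.recursive hE (Model.truth_box.1 (ih₁ m hm) hE')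
  | boxBotE hE _ ih =>
    exact fun m hm => absurd (Model.truth_box.1 (ih m hm) hE) (Model.not_truth_bot _)
  | botBoxE hx h h' =>
    exact fun m hm => Model.truth_box.2 fun hE => absurd (hE _ _ _ h h') hx
  | @boxCtr _ e E _ _ ih =>
    intro m hm
    refine Model.truth_box.2 fun hE => ?_
    rw [Model.doModel_congr (E' := e :: e :: E) hE (by simp)]
    exact Model.truth_box.1 (ih m hm) (hE.mono (by simp))
  | @boxWk _ e E _ _ ih =>
    intro m hm
    refine Model.truth_box.2 fun hE => ?_
    rw [Model.doModel_congr (E' := e :: E) hE (by simp)]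
    exact Model.truth_box.1 (ih m hm) (hE.mono (by simp))
  | boxSub _ _ ih₁ ih₂ =>
    exact fun m hm => Model.truth_box.2 fun hE => ih₂ _ (by
      rintro _ rfl
      exact Model.truth_box.1 (ih₁ m hm) hE)
  | boxAndI _ _ ih₁ ih₂ =>
    exact fun m hm => Model.truth_box.2 fun hE =>
      ⟨Model.truth_box.1 (ih₁ m hm) hE, Model.truth_box.1 (ih₂ m hm) hE⟩
  | @boxOrDst _ E _ _ _ ih =>
    intro m hm
    have := Model.truth_box.1 (ih m hm)
    simp only [Model.Truth, Model.truth_box] at this ⊢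
    tauto
  | boxOrDstInv _ ih =>
    intro m hm
    have := ih m hm
    simp only [Model.Truth, Model.truth_box] at this ⊢
    tauto
  | boxExtr hE _ ih =>
    intro m hm
    refine Model.truth_box.2 fun h => ?_
    have hE' := h.mono (List.subset_append_right _ _)
    rw [← Model.doModel_doModel hE hE']
    exact Model.truth_box.1 (Model.truth_box.1 (ih m hm) hE) hE'
  | @boxExp _ E E' _ hd _ ih =>
    intro m hm
    refine Model.truth_box.2 fun hE => Model.truth_box.2 fun hE' => ?_
    rw [Model.doModel_doModel hE hE']
    -- With disjoint variables nothing is overridden, so `E ++ E'` is the merged antecedent.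
    rw [← remove_eq_self_of_disjoint hd] at ih
    exact Model.truth_box.1 (ih m hm) (hE.remove_append hE')
  | negBoxE _ ih =>
    intro m hm
    have := ih m hm
    simp only [Model.Truth, Model.truth_box] at this ⊢
    tauto
  | @recur _ n X hX _ ih =>
    intro m hm h
    -- `h` leads back from the last variable to the first, and the premises lead from the first to
    -- the last; together they close a directed cycle.
    have hlast := Model.transGen_of_truth_affects (hX.ne (Fin.last_pos.ne')) h
    have hpath : ∀ i : Fin (n + 2), Relation.ReflTransGen m.sys.Edge (X 0) (X i) := by
      intro i
      induction i using Fin.induction with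
      | zero => exact .refl
      | succ i hi =>
        exact hi.trans (Model.transGen_of_truth_affects
          (hX.ne i.castSucc_lt_succ.ne) (ih i m hm)).to_reflTransGen
    exact m.recursive _ (hlast.trans_left (hpath _))

/-! ### Weakening, compactness and maximal consistent sets -/

theorem Derives.mono {Γ Δ : Set (Form σ)} {φ : Form σ} (h : Derives Γ φ) (hs : Γ ⊆ Δ) :
    Derives Δ φ := by
  induction h generalizing Δ with
  | assumption h => exact .assumption (hs h)
  | valDef X => exact .valDef X
  | valUnq hx _ ih => exact .valUnq hx (ih hs)
  | andI _ _ ih₁ ih₂ => exact .andI (ih₁ hs) (ih₂ hs)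
  | andE₁ _ ih => exact .andE₁ (ih hs)
  | andE₂ _ ih => exact .andE₂ (ih hs)
  | orI₁ _ ih => exact .orI₁ (ih hs)
  | orI₂ _ ih => exact .orI₂ (ih hs)
  | orE _ _ _ ih ih₁ ih₂ =>
    exact .orE (ih hs) (ih₁ (Set.insert_subset_insert hs)) (ih₂ (Set.insert_subset_insert hs))
  | negI _ ih => exact .negI (ih (Set.insert_subset_insert hs))
  | negE _ _ ih₁ ih₂ => exact .negE (ih₁ hs) (ih₂ hs)
  | raa _ ih => exact .raa (ih (Set.insert_subset_insert hs))
  | boxEff h => exact .boxEff h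
  | boxCmp hγ _ _ ih₁ ih₂ => exact .boxCmp hγ (ih₁ hs) (ih₂ hs)
  | boxBotE hE _ ih => exact .boxBotE hE (ih hs)
  | botBoxE hx h h' => exact .botBoxE hx h h'
  | boxCtr _ ih => exact .boxCtr (ih hs)
  | boxWk _ ih => exact .boxWk (ih hs)
  | boxSub _ h ih _ => exact .boxSub (ih hs) h
  | boxAndI _ _ ih₁ ih₂ => exact .boxAndI (ih₁ hs) (ih₂ hs)
  | boxOrDst _ ih => exact .boxOrDst (ih hs)
  | boxOrDstInv _ ih => exact .boxOrDstInv (ih hs)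
  | boxExtr hE _ ih => exact .boxExtr hE (ih hs)
  | boxExp hd _ ih => exact .boxExp hd (ih hs)
  | negBoxE _ ih => exact .negBoxE (ih hs)
  | recur X hX _ ih => exact .recur X hX fun i => ih i hs

/-- Derivability from a finite part of a set of assumptions. -/
def FinDerives (Γ : Set (Form σ)) (φ : Form σ) : Prop :=
  ∃ Γ' ⊆ Γ, Γ'.Finite ∧ Derives Γ' φ

namespace FinDerives

variable {Γ : Set (Form σ)} {φ ψ χ : Form σ}

theorem of_empty (h : Derives ∅ φ) : FinDerives Γ φ :=
  ⟨∅, Set.empty_subset _, Set.finite_empty, h⟩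

theorem map (h : FinDerives Γ φ) (f : ∀ {Γ' : Set (Form σ)}, Derives Γ' φ → Derives Γ' ψ) :
    FinDerives Γ ψ :=
  let ⟨Γ', hs, hf, h⟩ := h
  ⟨Γ', hs, hf, f h⟩

theorem map₂ (h₁ : FinDerives Γ φ) (h₂ : FinDerives Γ ψ)
    (f : ∀ {Γ' : Set (Form σ)}, Derives Γ' φ → Derives Γ' ψ → Derives Γ' χ) :
    FinDerives Γ χ :=
  let ⟨_, hs₁, hf₁, h₁⟩ := h₁
  let ⟨_, hs₂, hf₂, h₂⟩ := h₂
  ⟨_, Set.union_subset hs₁ hs₂, hf₁.union hf₂, f (h₁.mono Set.subset_union_left)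
    (h₂.mono Set.subset_union_right)⟩

/-- Used for the rules that discharge `φ`: the discharged assumption is split off, so that the
remaining finite set lies inside `Γ`. -/
theorem exists_insert (h : FinDerives (insert φ Γ) ψ) :
    ∃ Γ' ⊆ Γ, Γ'.Finite ∧ Derives (insert φ Γ') ψ :=
  let ⟨Γ', hs, hf, h⟩ := h
  ⟨Γ' \ {φ}, by simpa [Set.sdiff_singleton_subset_iff] using hs, hf.subset Set.sdiff_subset,
    h.mono (by rw [Set.insert_sdiff_singleton]; exact Set.subset_insert _ _)⟩

end FinDerives

theorem Derives.finDerives {Γ : Set (Form σ)} {φ : Form σ} (h : Derives Γ φ) :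
    FinDerives Γ φ := by
  induction h with
  | @assumption _ φ h =>
    exact ⟨{φ}, Set.singleton_subset_iff.2 h, Set.finite_singleton _, .assumption rfl⟩
  | valDef X => exact .of_empty (.valDef X)
  | valUnq hx _ ih => exact ih.map (.valUnq hx)
  | andI _ _ ih₁ ih₂ => exact ih₁.map₂ ih₂ .andI
  | andE₁ _ ih => exact ih.map .andE₁
  | andE₂ _ ih => exact ih.map .andE₂
  | orI₁ _ ih => exact ih.map .orI₁
  | orI₂ _ ih => exact ih.map .orI₂
  | orE _ _ _ ih ih₁ ih₂ =>
    obtain ⟨Γ₀, hs₀, hf₀, h₀⟩ := ih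
    obtain ⟨Γ₁, hs₁, hf₁, h₁⟩ := ih₁.exists_insert
    obtain ⟨Γ₂, hs₂, hf₂, h₂⟩ := ih₂.exists_insert
    refine ⟨Γ₀ ∪ (Γ₁ ∪ Γ₂), Set.union_subset hs₀ (Set.union_subset hs₁ hs₂),
      hf₀.union (hf₁.union hf₂), .orE (h₀.mono Set.subset_union_left) (h₁.mono ?_) (h₂.mono ?_)⟩
    · exact Set.insert_subset_insert (Set.subset_union_left.trans Set.subset_union_right)
    · exact Set.insert_subset_insert (Set.subset_union_right.trans Set.subset_union_right)
  | negI _ ih =>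
    obtain ⟨Γ', hs, hf, h⟩ := ih.exists_insert
    exact ⟨Γ', hs, hf, .negI h⟩
  | negE _ _ ih₁ ih₂ => exact ih₁.map₂ ih₂ .negE
  | raa _ ih =>
    obtain ⟨Γ', hs, hf, h⟩ := ih.exists_insert
    exact ⟨Γ', hs, hf, .raa h⟩
  | boxEff h => exact .of_empty (.boxEff h)
  | boxCmp hγ _ _ ih₁ ih₂ => exact ih₁.map₂ ih₂ (.boxCmp hγ)
  | boxBotE hE _ ih => exact ih.map (.boxBotE hE)
  | botBoxE hx h h' => exact .of_empty (.botBoxE hx h h')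
  | boxCtr _ ih => exact ih.map .boxCtr
  | boxWk _ ih => exact ih.map .boxWk
  | boxSub _ h ih _ => exact ih.map (.boxSub · h)
  | boxAndI _ _ ih₁ ih₂ => exact ih₁.map₂ ih₂ .boxAndI
  | boxOrDst _ ih => exact ih.map .boxOrDst
  | boxOrDstInv _ ih => exact ih.map .boxOrDstInv
  | boxExtr hE _ ih => exact ih.map (.boxExtr hE)
  | boxExp hd _ ih => exact ih.map (.boxExp hd)
  | negBoxE _ ih => exact ih.map .negBoxE
  | recur X hX _ ih =>
    choose Γ' hs hf h using ih
    exact ⟨⋃ i, Γ' i, Set.iUnion_subset hs, Set.finite_iUnion hf,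
      .recur X hX fun i => (h i).mono (Set.subset_iUnion Γ' i)⟩

/-- Consistent sets of formulas deciding every formula. -/
structure IsMaxConsistent (Γ : Set (Form σ)) : Prop where
  not_derives_bot : ¬ Derives Γ .bot
  mem_or_neg_mem : ∀ φ, φ ∈ Γ ∨ .neg φ ∈ Γ

/-- Lindenbaum's lemma. By compactness of derivability, being consistent is a property of finite
character, so maximal consistent extensions exist. -/
theorem exists_isMaxConsistent {Γ : Set (Form σ)} (h : ¬ Derives Γ .bot) :
    ∃ Γ', Γ ⊆ Γ' ∧ IsMaxConsistent Γ' := by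
  have hF : Order.IsOfFiniteCharacter {Γ : Set (Form σ) | ¬ Derives Γ .bot} := by
    intro Γ
    refine ⟨fun h Γ' hs _ h' => h (h'.mono hs), fun h h' => ?_⟩
    obtain ⟨Γ', hs, hf, h'⟩ := h'.finDerives
    exact h Γ' hs hf h'
  obtain ⟨Γ', hs, hΓ'⟩ := hF.exists_maximal h
  refine ⟨Γ', hs, hΓ'.prop, fun φ => ?_⟩
  by_contra! hc
  have key : ∀ ψ, ψ ∉ Γ' → Derives (insert ψ Γ') .bot := fun ψ hψ => by
    by_contra h'
    exact hψ (hΓ'.le_of_ge h' (Set.subset_insert _ _) (Set.mem_insert _ _))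
  -- If both `φ` and `¬φ` lead to `⊥`, then RAA yields `φ` and negation introduction yields `¬φ`.
  exact hΓ'.prop (.negE (.raa (key _ hc.2)) (.negI (key _ hc.1)))

/-! ### Derived rules for disjunctions and counterfactuals -/

theorem Derives.bigOr {Γ : Set (Form σ)} {φ : Form σ} {L : List (Form σ)} (hφ : φ ∈ L)
    (h : Derives Γ φ) : Derives Γ (.bigOr L) := by
  induction L with
  | nil => simp at hφ
  | cons ψ L ih =>
    cases L with
    | nil => rwa [Form.bigOr, ← List.mem_singleton.1 hφ]
    | cons χ L =>
      rcases List.mem_cons.1 hφ with rfl | hφ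
      · exact .orI₁ h
      · exact .orI₂ (ih hφ)

theorem Derives.iOr {ι : Type*} [Finite ι] {Γ : Set (Form σ)} {f : ι → Form σ} (i : ι)
    (h : Derives Γ (f i)) : Derives Γ (.iOr f) :=
  h.bigOr (by simp)

/-- Necessitation. Sub needs some counterfactual with antecedent `E` as its premise; Eff supplies
one when `E` is nonempty. -/
theorem Derives.box_of_valid {Γ : Set (Form σ)} {φ : Form σ} (h : ∀ Γ, Derives Γ φ)
    (E : List (Eqn σ)) : Derives Γ (.box E φ) := by
  cases E with
  | nil => exact h Γ
  | cons e E => exact .boxSub (.boxEff List.mem_cons_self) (h _)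

/-- A conjunction of equations, and a further formula. -/
def Form.conj (L : List (Eqn σ)) (φ : Form σ) : Form σ :=
  L.foldr (fun e ψ => .and (.eq e.1 e.2) ψ) φ

/-- Sub admits a single assumption, so several facts that hold under `E` must be packed into one
conjunction; `of_conj` unpacks them in the subderivation. -/
theorem Derives.box_conj {Γ : Set (Form σ)} {E L : List (Eqn σ)} {φ : Form σ}
    (hL : ∀ e ∈ L, Derives Γ (.box E (.eq e.1 e.2))) (h : Derives Γ (.box E φ)) :
    Derives Γ (.box E (.conj L φ)) := by
  induction L with
  | nil => exact h
  | cons e L ih =>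
    rw [List.forall_mem_cons] at hL
    exact .boxAndI hL.1 (ih hL.2)

theorem Derives.of_conj {Γ : Set (Form σ)} {L : List (Eqn σ)} {φ : Form σ}
    (h : Derives Γ (.conj L φ)) : (∀ e ∈ L, Derives Γ (.eq e.1 e.2)) ∧ Derives Γ φ := by
  induction L with
  | nil => exact ⟨by simp, h⟩
  | cons e L ih =>
    have := ih (.andE₂ h)
    exact ⟨List.forall_mem_cons.2 ⟨.andE₁ h, this.1⟩, this.2⟩

/-- Intervening to bring about the facts changes nothing. -/
theorem Derives.box_of_facts {Γ : Set (Form σ)} {L : List (Eqn σ)}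
    (hL : ∀ e ∈ L, Derives Γ (.eq e.1 e.2)) {γ : Form σ} (hγ : γ.BoxFree) (h : Derives Γ γ) :
    Derives Γ (.box L γ) := by
  induction L using List.reverseRecOn generalizing γ with
  | nil => exact h
  | append_singleton L e ih =>
    have hL' : ∀ e ∈ L, Derives Γ (.eq e.1 e.2) := fun e he => hL e (by simp [he])
    -- Cmp adds the last equation. It needs both `γ` and that equation under the shorter antecedent,
    -- hence two uses of the hypothesis generalized over `γ`.
    exact .boxCmp hγ (ih hL' trivial (hL e (by simp))) (ih hL' hγ h)

/-! ### Maximal consistent sets -/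

namespace IsMaxConsistent

variable {Γ : Set (Form σ)} {E E' : List (Eqn σ)} {φ ψ : Form σ}

theorem mem_of_derives (h : IsMaxConsistent Γ) (hφ : Derives Γ φ) : φ ∈ Γ :=
  (h.mem_or_neg_mem φ).resolve_right fun h' => h.not_derives_bot (.negE hφ (.assumption h'))

theorem neg_mem_iff (h : IsMaxConsistent Γ) : .neg φ ∈ Γ ↔ φ ∉ Γ :=
  ⟨fun h₁ h₂ => h.not_derives_bot (.negE (.assumption h₂) (.assumption h₁)),
    (h.mem_or_neg_mem φ).resolve_left⟩

theorem or_mem_iff (h : IsMaxConsistent Γ) : .or φ ψ ∈ Γ ↔ φ ∈ Γ ∨ ψ ∈ Γ := by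
  constructor
  · intro h'
    by_contra! hc
    rw [← h.neg_mem_iff, ← h.neg_mem_iff] at hc
    exact h.not_derives_bot (.orE (.assumption h')
      (.negE (.assumption (Set.mem_insert _ _)) (.assumption (Set.mem_insert_of_mem _ hc.1)))
      (.negE (.assumption (Set.mem_insert _ _)) (.assumption (Set.mem_insert_of_mem _ hc.2))))
  · rintro (h' | h')
    · exact h.mem_of_derives (.orI₁ (.assumption h'))
    · exact h.mem_of_derives (.orI₂ (.assumption h'))

theorem box_mem_of_box_mem (h : IsMaxConsistent Γ) (hφ : .box E φ ∈ Γ) (h' : Derives {φ} ψ) :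
    .box E ψ ∈ Γ :=
  h.mem_of_derives (.boxSub (.assumption hφ) h')

theorem box_and_mem_iff (h : IsMaxConsistent Γ) :
    .box E (.and φ ψ) ∈ Γ ↔ .box E φ ∈ Γ ∧ .box E ψ ∈ Γ :=
  ⟨fun h' => ⟨h.box_mem_of_box_mem h' (.andE₁ (.assumption rfl)),
    h.box_mem_of_box_mem h' (.andE₂ (.assumption rfl))⟩,
    fun h' => h.mem_of_derives (.boxAndI (.assumption h'.1) (.assumption h'.2))⟩

theorem box_or_mem_iff (h : IsMaxConsistent Γ) :
    .box E (.or φ ψ) ∈ Γ ↔ .box E φ ∈ Γ ∨ .box E ψ ∈ Γ := by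
  rw [← h.or_mem_iff]
  exact ⟨fun h' => h.mem_of_derives (.boxOrDst (.assumption h')),
    fun h' => h.mem_of_derives (.boxOrDstInv (.assumption h'))⟩

theorem box_bot_notMem (h : IsMaxConsistent Γ) (hE : Consistent E) : .box E .bot ∉ Γ :=
  fun h' => h.not_derives_bot (.boxBotE hE (.assumption h'))

theorem box_neg_mem_iff (h : IsMaxConsistent Γ) (hE : Consistent E) :
    .box E (.neg φ) ∈ Γ ↔ .box E φ ∉ Γ := by
  constructor
  · intro h₁ h₂
    exact h.box_bot_notMem hE (h.box_mem_of_box_mem (h.box_and_mem_iff.2 ⟨h₂, h₁⟩)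
      (.negE (.andE₁ (.assumption rfl)) (.andE₂ (.assumption rfl))))
  · intro h'
    exact h.mem_of_derives (.negBoxE (.assumption (h.neg_mem_iff.2 h')))

theorem exists_box_mem_of_box_bigOr_mem (h : IsMaxConsistent Γ) (hE : Consistent E)
    {L : List (Form σ)} (hL : .box E (.bigOr L) ∈ Γ) : ∃ φ ∈ L, .box E φ ∈ Γ := by
  induction L with
  | nil => exact absurd hL (h.box_bot_notMem hE)
  | cons φ L ih =>
    cases L with
    | nil => exact ⟨φ, by simp, hL⟩
    | cons ψ L =>
      rw [Form.bigOr, h.box_or_mem_iff] at hL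
      rcases hL with hL | hL
      · exact ⟨φ, by simp, hL⟩
      · obtain ⟨χ, hχ, h'⟩ := ih hL
        exact ⟨χ, List.mem_cons_of_mem _ hχ, h'⟩

/-- Existence: the disjunction over the range of `V` holds under any antecedent, and counterfactuals
distribute over it. Uniqueness: a second value would put `V = v` and `V ≠ v` under the same
consistent antecedent. -/
theorem existsUnique_box_eq_mem (h : IsMaxConsistent Γ) (hE : Consistent E) (V : σ.Dom) :
    ∃! v, .box E (.eq V v) ∈ Γ := by
  obtain ⟨φ, hφ, h'⟩ := h.exists_box_mem_of_box_bigOr_mem hE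
    (h.mem_of_derives (.box_of_valid (fun Γ => .valDef V) E))
  simp only [List.mem_map] at hφ
  obtain ⟨v, -, rfl⟩ := hφ
  refine ⟨v, h', fun w hw => ?_⟩
  by_contra hne
  exact (h.box_neg_mem_iff hE).1 (h.box_mem_of_box_mem hw (.valUnq hne (.assumption rfl))) h'

/-- Nested counterfactuals can be merged within maximal consistent sets. -/
theorem box_box_mem_iff (h : IsMaxConsistent Γ) (hE : Consistent E) (hE' : Consistent E') :
    .box E (.box E' φ) ∈ Γ ↔ .box (remove E E' ++ E') φ ∈ Γ := by
  refine ⟨fun h' => h.mem_of_derives (.boxExtr hE (.assumption h')), fun h' => ?_⟩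
  -- Exp would require disjoint variables. Instead, the failure of the nested formula is turned into
  -- `E □→ (E' □→ ¬φ)` and merged by Extr, contradicting `h'`.
  by_contra hc
  rw [← h.box_neg_mem_iff hE] at hc
  have := h.mem_of_derives
    (.boxExtr hE (.boxSub (.assumption hc) (.negBoxE (.assumption rfl))))
  exact (h.box_neg_mem_iff (hE.remove_append hE')).1 this h'

end IsMaxConsistent

/-! ### Systems of responses to interventions -/

open Classical in
/-- The equations true in `t` that concern the variables in `S`. -/
noncomputable def eqnsOn (S : Set σ.Dom) (t : Assignment σ) : List (Eqn σ) :=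
  Form.eqns S.toFinite.toFinset fun V => t V

theorem mem_eqnsOn {S : Set σ.Dom} {t : Assignment σ} {e : Eqn σ} :
    e ∈ eqnsOn S t ↔ e.1 ∈ S ∧ t e.1 = e.2 := by
  simp [eqnsOn, Form.mem_eqns]

theorem consistent_of_forall_eq {E : List (Eqn σ)} {t : Assignment σ}
    (h : ∀ e ∈ E, t e.1 = e.2) : Consistent E :=
  fun _ _ _ h₁ h₂ => (h _ h₁).symm.trans (h _ h₂)

theorem consistent_eqnsOn (S : Set σ.Dom) (t : Assignment σ) : Consistent (eqnsOn S t) :=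
  consistent_of_forall_eq fun _ he => (mem_eqnsOn.1 he).2

/-- A family of assignments, thought of as the results of all interventions, in which interventions
are effective and composing one with an intervention that changes nothing has no effect. -/
structure IsResponse (R : List (Eqn σ) → Assignment σ) : Prop where
  eff : ∀ {E}, Consistent E → ∀ e ∈ E, R E e.1 = e.2
  comp : ∀ {E E'}, Consistent E → E ⊆ E' → (∀ e ∈ E', R E e.1 = e.2) → R E' = R E

/-- `X` causally affects `Y` in a system of responses. -/
def Influences (R : List (Eqn σ) → Assignment σ) (X Y : σ.Dom) : Prop :=
  X ≠ Y ∧ ∃ (S : Set σ.Dom) (t : Assignment σ) (x x' : σ.Ran X), X ∉ S ∧ Y ∉ S ∧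
    R (eqnsOn S t ++ [⟨X, x⟩]) Y ≠ R (eqnsOn S t ++ [⟨X, x'⟩]) Y

namespace IsResponse

variable {R : List (Eqn σ) → Assignment σ}

theorem congr (hR : IsResponse R) {E E' : List (Eqn σ)} (hE : Consistent E)
    (h : ∀ e, e ∈ E ↔ e ∈ E') : R E' = R E :=
  hR.comp hE (fun e => (h e).1) fun e he => hR.eff hE e ((h e).2 he)

theorem eqnsOn_compl_congr (hR : IsResponse R) {V : σ.Dom} {t t' : Assignment σ}
    (h : ∀ W, W ≠ V → t W = t' W) : R (eqnsOn {V}ᶜ t) = R (eqnsOn {V}ᶜ t') := by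
  refine hR.congr (consistent_eqnsOn _ _) fun e => ?_
  rw [mem_eqnsOn, mem_eqnsOn]
  exact and_congr_right fun he => by rw [h _ he]

/-- With every variable other than `W` and `V` held fixed, a change at `W` that altered `V` would be
a witness of influence. -/
theorem eqnsOn_compl_eq_of_not_influences (hR : IsResponse R) {W V : σ.Dom} (hWV : W ≠ V)
    (h : ¬ Influences R W V) {t t' : Assignment σ} (htt' : ∀ U, U ≠ W → t U = t' U) :
    R (eqnsOn {V}ᶜ t) V = R (eqnsOn {V}ᶜ t') V := by
  have split : ∀ t'' : Assignment σ, (∀ U, U ≠ W → t U = t'' U) →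
      R (eqnsOn {V}ᶜ t'') = R (eqnsOn {W, V}ᶜ t ++ [⟨W, t'' W⟩]) := by
    intro t'' ht''
    refine (hR.congr (consistent_eqnsOn _ _) fun e => ?_).symm
    obtain ⟨U, y⟩ := e
    simp only [mem_eqnsOn, List.mem_append, List.mem_singleton, Set.mem_compl_iff,
      Set.mem_insert_iff, Set.mem_singleton_iff]
    by_cases hU : U = W
    · subst hU
      simp [hWV, eq_comm]
    · have : (⟨U, y⟩ : Eqn σ) ≠ ⟨W, t'' W⟩ := fun h => hU (congrArg Sigma.fst h)
      simp [hU, this, ht'' U hU]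
  rw [split t fun _ _ => rfl, split t' htt']
  by_contra hne
  exact h ⟨hWV, {W, V}ᶜ, t, t W, t' W, by simp, by simp, hne⟩

/-- The response of `V` to fixing all other variables depends only on those that influence `V`: the
variables are switched one at a time, each switch being harmless. -/
theorem eqnsOn_compl_eq (hR : IsResponse R) {V : σ.Dom} {t t' : Assignment σ}
    (h : ∀ W, Influences R W V → t W = t' W) :
    R (eqnsOn {V}ᶜ t) V = R (eqnsOn {V}ᶜ t') V := by
  classical
  have key : ∀ (S : Finset σ.Dom) (t' : Assignment σ), (∀ W ∉ S, t W = t' W) →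
      (∀ W, Influences R W V → t W = t' W) →
      R (eqnsOn {V}ᶜ t) V = R (eqnsOn {V}ᶜ t') V := by
    intro S
    induction S using Finset.induction with
    | empty => exact fun t' h _ => by rw [funext fun W => h W (by simp)]
    | insert a S _ ih =>
      intro t' h h'
      have h₁ : ∀ U, U ≠ a → Function.update t' a (t a) U = t' U := fun U hU => by
        rw [Function.update_of_ne hU]
      -- The intermediate assignment differs from `t` only within `S`. Passing from it to `t'`
      -- changes only `a`, which is `V` itself, or influences `V` and so already has the same value,
      -- or does not influence `V`.
      rw [ih (Function.update t' a (t a))]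
      · by_cases haV : a = V
        · subst haV
          rw [hR.eqnsOn_compl_congr h₁]
        by_cases hi : Influences R a V
        · rw [h' a hi, Function.update_eq_self]
        · exact hR.eqnsOn_compl_eq_of_not_influences haV hi h₁
      · intro W hW
        by_cases hWa : W = a
        · subst hWa
          rw [Function.update_self]
        · rw [h₁ W hWa]
          exact h W (by simp [hWa, hW])
      · intro W hW
        by_cases hWa : W = a
        · subst hWa
          rw [Function.update_self]
        · rw [h₁ W hWa]
          exact h' W hW
  exact key Set.finite_univ.toFinset t' (by simp) h

end IsResponse

/-- The system of functions read off a system of responses: the parents of a variable are those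
that causally affect it, and its value is the response to an intervention on all others. -/
noncomputable def responseSystem (R : List (Eqn σ) → Assignment σ) : FunSystem σ where
  En := Set.univ
  PA V := {W | Influences R W V}
  not_mem_PA _ h := h.1 rfl
  fn V p :=
    -- The default `R [] W` for non-parents is immaterial, by `IsResponse.eqnsOn_compl_eq`.
    open Classical in
    R (eqnsOn {V.1}ᶜ fun W => if h : Influences R W V then p ⟨W, h⟩ else R [] W) V

namespace IsResponse

variable {R : List (Eqn σ) → Assignment σ}

/-- Starting from `E`, fixing all variables but `V` at the values they already have in `R E` changes
nothing, by `comp`; so `R E` solves the equation of `V`. -/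
theorem responseSystem_fn (hR : IsResponse R) {E : List (Eqn σ)} (hE : Consistent E) {V : σ.Dom}
    (hV : V ∉ vars E) :
    (responseSystem R).fn ⟨V, trivial⟩ (fun W => R E W) = R E V := by
  have h₁ : R (eqnsOn {V}ᶜ (R E)) = R E := by
    refine hR.comp hE (fun e he => mem_eqnsOn.2 ⟨?_, hR.eff hE e he⟩)
      fun e he => (mem_eqnsOn.1 he).2
    rintro rfl
    exact hV ⟨e.2, he⟩
  refine Eq.trans (hR.eqnsOn_compl_eq (t' := R E) fun W hW => ?_) (congrFun h₁ V)
  exact dif_pos hW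

theorem compatible (hR : IsResponse R) : (responseSystem R).Compatible (R []) :=
  fun V => (hR.responseSystem_fn consistent_nil (V := V) (by simp [vars_nil])).symm

theorem doAssignment_eq (hR : IsResponse R) (hF : (responseSystem R).IsRecursive)
    {E : List (Eqn σ)} (hE : Consistent E) :
    (responseSystem R).doAssignment hF E (R []) = R E :=
  ((responseSystem R).eq_doAssignment hF hE (hR.eff hE)
    (fun _ hV _ => (hR.responseSystem_fn hE hV).symm)
    (fun _ _ h => absurd trivial h)).symm

end IsResponse

/-! ### Simple cycles and recursiveness of the response system -/

theorem _root_.Relation.TransGen.exists_path {α : Type*} {r : α → α → Prop} {a b : α}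
    (h : Relation.TransGen r a b) :
    ∃ n, 0 < n ∧ ∃ f : ℕ → α, f 0 = a ∧ f n = b ∧ ∀ i < n, r (f i) (f (i + 1)) := by
  induction h using Relation.TransGen.head_induction_on with
  | @single a h =>
    refine ⟨1, one_pos, fun i => Nat.casesOn i a fun _ => b, rfl, rfl, fun i hi => ?_⟩
    obtain rfl : i = 0 := by omega
    exact h
  | @head a c hac _ ih =>
    obtain ⟨n, -, f, h₀, hn, hf⟩ := ih
    refine ⟨n + 1, n.succ_pos, fun i => Nat.casesOn i a f, rfl, hn, fun i hi => ?_⟩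
    cases i with
    | zero => exact (congrArg (r a) h₀).mpr hac
    | succ i => exact hf i (by omega)

/-- A cycle of an irreflexive relation contains a cycle without repetitions. -/
theorem _root_.Relation.TransGen.exists_injective_cycle {α : Type*} {r : α → α → Prop}
    (hr : ∀ a, ¬ r a a) {a : α} (h : Relation.TransGen r a a) :
    ∃ (n : ℕ) (X : Fin (n + 2) → α), Function.Injective X ∧
      (∀ i : Fin (n + 1), r (X i.castSucc) (X i.succ)) ∧ r (X (Fin.last (n + 1))) (X 0) := by
  classical
  have hex : ∃ n, 0 < n ∧ ∃ f : ℕ → α, f 0 = f n ∧ ∀ i < n, r (f i) (f (i + 1)) := by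
    obtain ⟨n, hn, f, h₀, h₁, hf⟩ := h.exists_path
    exact ⟨n, hn, f, h₀.trans h₁.symm, hf⟩
  -- A closed walk of minimal positive length is taken. Length one is a loop, excluded by `hr`; in a
  -- longer one, a repeated vertex would cut out a shorter closed walk.
  obtain ⟨hpos, f, hcyc, hf⟩ := Nat.find_spec hex
  have hmin := fun m => Nat.find_min (m := m) hex
  generalize Nat.find hex = N at *
  obtain _ | _ | n := N
  · omega
  · exact absurd (hcyc ▸ hf 0 one_pos) (hr _)
  · refine ⟨n, fun i => f i, ?_, fun i => hf i (by omega), ?_⟩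
    · have hne : ∀ i j, i < j → j < n + 2 → f i ≠ f j := by
        intro i j hij hj he
        refine hmin (j - i) (by omega) ⟨by omega, fun k => f (i + k), ?_, fun k hk =>
          hf (i + k) (by omega)⟩
        simpa [Nat.add_sub_cancel' hij.le] using he
      intro i j hij
      rcases lt_trichotomy i j with hlt | heq | hlt
      · exact absurd hij (hne i j hlt j.2)
      · exact heq
      · exact absurd hij.symm (hne j i hlt i.2)
    · have := hf (n + 1) (by omega)
      rw [← hcyc] at this
      exact this

theorem isRecursive_responseSystem {R : List (Eqn σ) → Assignment σ}
    (h : ∀ (n : ℕ) (X : Fin (n + 2) → σ.Dom), Function.Injective X →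
      (∀ i : Fin (n + 1), Influences R (X i.castSucc) (X i.succ)) →
      ¬ Influences R (X (Fin.last (n + 1))) (X 0)) : (responseSystem R).IsRecursive := by
  intro X hX
  obtain ⟨n, Y, hY, h₁, h₂⟩ :=
    hX.exists_injective_cycle fun a ha => (responseSystem R).not_mem_PA ⟨a, ha.1⟩ ha.2
  exact h n Y hY (fun i => (h₁ i).2) h₂.2

/-! ### The canonical model -/

namespace IsMaxConsistent

variable {Γ : Set (Form σ)}

theorem exists_response (h : IsMaxConsistent Γ) : ∃ R : List (Eqn σ) → Assignment σ,
    ∀ E, Consistent E → ∀ V v, .box E (.eq V v) ∈ Γ ↔ R E V = v := by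
  choose! R h₁ h₂ using fun (E : List (Eqn σ)) (hE : Consistent E) =>
    Classical.skolem.1 fun V => h.existsUnique_box_eq_mem hE V
  exact ⟨R, fun E hE V v => ⟨fun hv => (h₂ E hE V v hv).symm, fun hv => hv ▸ h₁ E hE V⟩⟩

variable {R : List (Eqn σ) → Assignment σ}

/-- For `comp`: under `E` all equations of `E'` are facts, so intervening on `E'` there keeps the
value of `V`. Extr merges the two antecedents, and since `E ⊆ E'` only `E'` remains. -/
theorem isResponse (h : IsMaxConsistent Γ)
    (hR : ∀ E, Consistent E → ∀ V v, .box E (.eq V v) ∈ Γ ↔ R E V = v) : IsResponse R where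
  eff hE e he := (hR _ hE _ _).1 (h.mem_of_derives (.boxEff he))
  comp {E E'} hE hEE' hE' := by
    funext V
    refine (hR _ (consistent_of_forall_eq hE') _ _).1 (h.mem_of_derives ?_)
    have h₁ : Derives Γ (.box E (.conj E' (.eq V (R E V)))) :=
      .box_conj (fun e he => .assumption ((hR E hE _ _).2 (hE' e he)))
        (.assumption ((hR E hE _ _).2 rfl))
    have h₂ : Derives {Form.conj E' (.eq V (R E V))} (.box E' (.eq V (R E V))) :=
      have h₃ := Derives.of_conj (.assumption (Set.mem_singleton _))
      .box_of_facts h₃.1 trivial h₃.2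
    have h₄ := Derives.boxExtr hE (.boxSub h₁ h₂)
    rwa [remove_eq_nil_of_subset hEE', List.nil_append] at h₄

/-- A witness of influence names a disjunct of `X ⇝ Y`: as `X ∉ S`, Exp separates the context from
the setting of `X`. The two settings differ because their responses do. -/
theorem derives_affects
    (hR : ∀ E, Consistent E → ∀ V v, .box E (.eq V v) ∈ Γ ↔ R E V = v) {X Y : σ.Dom}
    (hXY : Influences R X Y) : Derives Γ (.affects X Y) := by
  obtain ⟨-, S, t, x, x', hX, hY, hne⟩ := hXY
  have hdisj : ∀ x : σ.Ran X, Disjoint (vars (eqnsOn S t)) (vars [(⟨X, x⟩ : Eqn σ)]) := by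
    intro x
    rw [Set.disjoint_left]
    rintro V ⟨v, hv⟩ ⟨w, hw⟩
    rw [List.mem_singleton] at hw
    cases hw
    exact hX (mem_eqnsOn.1 hv).1
  have hcons : ∀ x : σ.Ran X, Consistent (eqnsOn S t ++ [⟨X, x⟩]) := by
    intro x
    have := (consistent_eqnsOn S t).remove_append (consistent_singleton ⟨X, x⟩)
    rwa [remove_eq_self_of_disjoint (hdisj x)] at this
  have hbox : ∀ x : σ.Ran X, Derives Γ (.box (eqnsOn S t)
      (.box [⟨X, x⟩] (.eq Y (R (eqnsOn S t ++ [⟨X, x⟩]) Y)))) := fun x =>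
    .boxExp (hdisj x) (.assumption ((hR _ (hcons x) _ _).2 rfl))
  refine Derives.iOr (ι := Form.AffectsIndex X Y)
    ⟨⟨⟨S.toFinite.toFinset, by simp [hX, hY]⟩, fun V => t V⟩,
      ⟨(x, x'), fun hx => hne ?_⟩, ⟨(_, _), hne⟩⟩ (.boxAndI (hbox x) (hbox x'))
  rw [show x = x' from hx]

/-- Every maximal consistent set is the theory of a causal model. -/
theorem exists_model (h : IsMaxConsistent Γ) : ∃ m : Model σ, ∀ φ, φ ∈ Γ ↔ m.Truth φ := by
  obtain ⟨R, hR⟩ := h.exists_response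
  have hresp := h.isResponse hR
  have hrec : (responseSystem R).IsRecursive :=
    isRecursive_responseSystem fun n X hX h₁ h₂ => h.not_derives_bot
      (.negE (derives_affects hR h₂) (.recur X hX fun i => derives_affects hR (h₁ i)))
  let m : Model σ := ⟨R [], responseSystem R, hrec, hresp.compatible⟩
  -- Stated for all consistent `E`, so that a nested counterfactual can call the hypothesis at the
  -- merged antecedent; the theory itself is the case of the empty `E`.
  have key : ∀ φ E, Consistent E → (.box E φ ∈ Γ ↔ (m.doModel E).Truth φ) := by
    intro φ
    induction φ with
    | eq X x =>
      intro E hE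
      rw [hR E hE, Model.Truth, ← hresp.doAssignment_eq hrec hE]
      rfl
    | neg φ ih => exact fun E hE => by rw [h.box_neg_mem_iff hE, ih E hE, Model.Truth]
    | and φ ψ ih₁ ih₂ =>
      exact fun E hE => by rw [h.box_and_mem_iff, ih₁ E hE, ih₂ E hE, Model.Truth]
    | or φ ψ ih₁ ih₂ =>
      exact fun E hE => by rw [h.box_or_mem_iff, ih₁ E hE, ih₂ E hE, Model.Truth]
    | cf e E' φ ih =>
      intro E hE
      rw [Model.Truth]
      by_cases hE' : Consistent (e :: E')
      · rw [Model.doModel_doModel hE hE', ← ih _ (hE.remove_append hE'),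
          ← h.box_box_mem_iff hE hE']
        exact (imp_iff_right hE').symm
      -- With an inconsistent inner antecedent both sides hold: the inner counterfactual is a
      -- theorem, hence also under `E`.
      · refine iff_of_true (h.mem_of_derives (.box_of_valid (fun Δ => ?_) E))
          fun h' => absurd h' hE'
        simp only [Consistent, not_forall] at hE'
        obtain ⟨X, x, x', hx, hx', hne⟩ := hE'
        exact .botBoxE (E := e :: E') hne hx hx'
  refine ⟨m, fun φ => ?_⟩
  rw [← m.doModel_nil]
  exact key φ [] consistent_nil

end IsMaxConsistent

/-! ### Completeness -/

theorem EntailsM.derives {Δ : Set (Form σ)} {α : Form σ} (h : EntailsM Δ α) : Derives Δ α := by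
  by_contra hc
  obtain ⟨Γ, hΔ, hΓ⟩ := exists_isMaxConsistent fun h' => hc (.raa h')
  obtain ⟨m, hm⟩ := hΓ.exists_model
  rw [Set.insert_subset_iff] at hΔ
  exact (hm _).1 hΔ.1 (h m fun δ hδ => (hm δ).1 (hΔ.2 hδ))

theorem derives_iff_entailsM {Δ : Set (Form σ)} {α : Form σ} :
    Derives Δ α ↔ EntailsM Δ α :=
  ⟨Derives.sound, EntailsM.derives⟩

end CausalLogic

theorem theorem4p4 (σ : CausalLogic.Signature.{u, v}) (Δ : Set (CausalLogic.Form σ))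
    (α : CausalLogic.Form σ) :
    (CausalLogic.Derives Δ α ↔ CausalLogic.EntailsC Δ α) ∧
      (CausalLogic.Derives Δ α ↔ CausalLogic.EntailsG Δ α) :=
  ⟨CausalLogic.derives_iff_entailsM.trans CausalLogic.entailsC_iff.symm,
    CausalLogic.derives_iff_entailsM.trans CausalLogic.entailsG_iff.symm⟩
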